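/- Setting. Let $n\ge 1$. For $k\in\{1,\dots,n\}$, a label vector $z\in[k]^n$ and $Q\in\mathbb{R}^{k\times k}$ let $\mathscr{X}_z(Q)\in\mathbb{R}^{n\times n}$ be the matrix with entries $Q_{z(i)z(j)}$ for $i\neq j$ and $0$ on the diagonal, and also write $\mathscr{X}_z$ for the matrix of this linear map. Put $\bar{\mathcal Z}_k=\{z\in[k]^n:\det(\mathscr{X}_z^T\mathscr{X}_z)>0\}$ (equivalently, each of the $k$ communities of $z$ has at least two nodes) and $\epsilon(k)=k^2+n\log k$; let $\|\cdot\|_F$ denote the Frobenius norm. Prior. For $\lambda,D>0$ the prior $\Pi$ on $(k,\theta)$ is: (1) draw $k$ among the $k\in\{1,\dots,n\}$ with $\bar{\mathcal Z}_k\neq\emptyset$, with probability proportional to $\frac{\Gamma(k^2)}{\Gamma(k^2/2)}e^{-D\epsilon(k)}$; (2) given $k$, draw $z$ uniformly from $\bar{\mathcal Z}_k$; (3) given $(k,z)$, draw $Q\in\mathbb{R}^{k\times k}$ from the density proportional to $e^{-\lambda\|\mathscr{X}_z(Q)\|_F}$; (4) set $\theta=\mathscr{X}_z(Q)$. The posterior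 $\Pi(\cdot\mid A)$ is obtained by Bayes' formula from this prior and the working Gaussian likelihood under which the entries $A_{ij}$, $i\neq j$, are independent $N(\theta_{ij},1)$. Data. Let $k^*\in\{1,\dots,n\}$, let $z^*\in[k^*]^n$ be a label vector no community of which consists of exactly one node, let $Q^*\in\mathbb{R}^{k^*\times k^*}$, and suppose that $\theta^*_{ij}=Q^*_{z^*(i)z^*(j)}=Q^*_{z^*(j)z^*(i)}\in[0,1]$ for $i\ne j$ and $\theta^*_{ii}=0$. Let $A=A^T\in\{0,1\}^{n\times n}$ be a random adjacency matrix with $A_{ii}=0$ whose entries $(A_{ij})_{i>j}$ are independent Bernoulli variables with means $\theta^*_{ij}$; $\mathbb{E}$ denotes expectation over $A$. Claim. For every $\lambda>0$ and every $\delta\in(0,1)$ there is a constant $D_{\lambda,\delta}>0$ depending only on $\lambda,\delta$ such that for every $D>D_{\lambda,\delta}$ there are constants $M,C',C''>0$ depending only on $\lambda,\delta,D$ such that, for all $n,k^*,z^*,Q^*,\theta^*$ and $A$ as above, $$\mathbb{E}\,\Pi\left(k^2+n\log k>(1+\delta)\left((k^*)^2+n\log k^*\right)\mid A\right)\le \exp\left(-C'\left((k^*)^2+n\log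 k^*\right)\right)$$ and $$\mathbb{E}\,\Pi\left(\|\theta-\theta^*\|_F^2>M\left((k^*)^2+n\log k^*\right)\mid A\right)\le \exp\left(-C''\left((k^*)^2+n\log k^*\right)\right).$$ -/

import Mathlib

open MeasureTheory ProbabilityTheory

noncomputable section

/-- The block mean matrix: `θ i j = Q (z i) (z j)` off the diagonal and `θ i i = 0`. -/
def sbmMean {n k : ℕ} (z : Fin n → Fin k) (Q : Fin k → Fin k → ℝ) : Fin n → Fin n → ℝ :=
  fun i j => if i = j then 0 else Q (z i) (z j)

/-- The matrix of the linear map `Q ↦ sbmMean z Q`: rows are indexed by pairs of nodes, columns by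
pairs of communities. -/
def sbmDesign {n k : ℕ} (z : Fin n → Fin k) : Matrix (Fin n × Fin n) (Fin k × Fin k) ℝ :=
  Matrix.of fun p q => if p.1 ≠ p.2 ∧ z p.1 = q.1 ∧ z p.2 = q.2 then 1 else 0

/-- Squared Frobenius norm. -/
def frobSq {n : ℕ} (B : Fin n → Fin n → ℝ) : ℝ := ∑ i, ∑ j, B i j ^ 2

/-- The complexity `k ^ 2 + n * log k`. -/
def sbmComplexity (n k : ℕ) : ℝ := (k : ℝ) ^ 2 + n * Real.log k

/-- The label vectors `z ∈ [k]^n` whose design has full column rank. -/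
def sbmLabels (n k : ℕ) : Finset (Fin n → Fin k) :=
  open Classical in
  Finset.univ.filter fun z => 0 < ((sbmDesign z).transpose * sbmDesign z).det

/-- The numbers of communities in `{1, …, n}` for which there is such a label vector. -/
def sbmModels (n : ℕ) : Finset ℕ :=
  open Classical in
  (Finset.Icc 1 n).filter fun k => (sbmLabels n k).Nonempty

/-- Unnormalized prior weight of `k` communities. -/
def sbmWeight (D : ℝ) (n k : ℕ) : ℝ :=
  Real.Gamma ((k : ℝ) ^ 2) / Real.Gamma ((k : ℝ) ^ 2 / 2) * Real.exp (-D * sbmComplexity n k)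

/-- Prior probability of `k` communities. -/
def sbmProb (D : ℝ) (n k : ℕ) : ℝ := sbmWeight D n k / ∑ j ∈ sbmModels n, sbmWeight D n j

/-- The elliptical Laplace density on `ℝ^(k × k)`, proportional to `exp (-lam * ‖sbmMean z Q‖)`,
with its normalizing constant. -/
def ellipticalLaplace (lam : ℝ) {n k : ℕ} (z : Fin n → Fin k) (Q : Fin k → Fin k → ℝ) : ℝ :=
  Real.sqrt ((sbmDesign z).transpose * sbmDesign z).det / 2
    * (lam / Real.sqrt Real.pi) ^ (k ^ 2)
    * (Real.Gamma ((k : ℝ) ^ 2 / 2) / Real.Gamma ((k : ℝ) ^ 2))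
    * Real.exp (-lam * Real.sqrt (frobSq (sbmMean z Q)))

/-- The prior, as the law of the pair `(k, θ)`: draw `k` from `sbmProb`, then `z` uniformly from
`sbmLabels n k`, then `Q` from the elliptical Laplace density, and put `θ = sbmMean z Q`. -/
def sbmPrior (lam D : ℝ) (n : ℕ) : Measure (ℕ × (Fin n → Fin n → ℝ)) :=
  ∑ k ∈ sbmModels n, ENNReal.ofReal (sbmProb D n k) •
    ∑ z ∈ sbmLabels n k, ((sbmLabels n k).card : ENNReal)⁻¹ •
      Measure.map (fun Q : Fin k → Fin k → ℝ => (k, sbmMean z Q))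
        ((volume : Measure (Fin k → Fin k → ℝ)).withDensity
          fun Q => ENNReal.ofReal (ellipticalLaplace lam z Q))

/-- The working likelihood: under `θ` the off-diagonal entries are independent `N(θ i j, 1)`. -/
def gaussianLikelihood {n : ℕ} (a θ : Fin n → Fin n → ℝ) : ENNReal :=
  ENNReal.ofReal (∏ p ∈ (Finset.univ : Finset (Fin n)).offDiag,
    gaussianPDFReal (θ p.1 p.2) 1 (a p.1 p.2))

/-- The posterior law of `(k, θ)` given the adjacency matrix `a`, by Bayes' formula applied to the
densities. -/
def sbmPosterior (lam D : ℝ) {n : ℕ} (a : Fin n → Fin n → ℝ) :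
    Measure (ℕ × (Fin n → Fin n → ℝ)) :=
  (∫⁻ x, gaussianLikelihood a x.2 ∂(sbmPrior lam D n))⁻¹ •
    (sbmPrior lam D n).withDensity fun x => gaussianLikelihood a x.2

/-- `A` is the adjacency matrix of an undirected random graph without self loops whose edges
`A i j`, `j < i`, are independent Bernoulli variables with means `θ i j`. -/
structure IsBernoulliGraph {n : ℕ} {Ω : Type*} [MeasurableSpace Ω] (P : Measure Ω)
    (A : Ω → Fin n → Fin n → ℝ) (θ : Fin n → Fin n → ℝ) : Prop where
  measurable : ∀ i j, Measurable fun ω => A ω i j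
  zero_or_one : ∀ ω i j, A ω i j = 0 ∨ A ω i j = 1
  symm : ∀ ω i j, A ω i j = A ω j i
  diag : ∀ ω i, A ω i i = 0
  mean : ∀ i j, j < i → P.real {ω | A ω i j = 1} = θ i j
  indep : iIndepFun
    (fun (e : {p : Fin n × Fin n // p.2 < p.1}) (ω : Ω) => A ω e.1.1 e.1.2) P

end

/-! Take likelihoods relative to the truth θ₀. The posterior mass of a set is then a prior integral
of exp(`logRatio`) over that set, divided by the integral over everything, the evidence.

The evidence has a lower bound valid for every data matrix. Within one block model, `logRatio` is an
explicit quadratic in Q; after the Laplace factor is bounded below, completing the square leaves a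
Gaussian and a nonnegative data term, which is dropped (`le_lintegral_laplaceKernel`). Since this
bound is not random, no tests or exceptional events are needed: Tonelli moves the expectation inside
the numerator, where sub-Gaussianity of the edges gives E exp(`logRatio`) ≤ exp(-‖θ-θ₀‖²/4). The
numerator is then also bounded by Gaussian integrals (`lintegral_laplaceKernel_le`).

Several factors disappear exactly: block sizes against the Laplace determinant, the Gamma factors
against the model weights, the normalizer of the model prior, and exp(-λ‖θ₀‖), which the triangle
inequality puts in both bounds. With C = `laplaceRate lam`, what survives for a set at squared
distance at least r from θ₀ is exp((D+C)ε(k₀) - r/16) times the sum of exp(-(D-C)ε(k)) over its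
models (`lintegral_sbmPosterior_le`). Overly complex models lose through this sum once D is large;
distant means lose through r. -/

noncomputable section

/-! ### Blocks, the Gram matrix and admissible labels -/

/-- The ordered pairs of distinct nodes that lie in a given pair of communities. -/
def blockPairs {n k : ℕ} (z : Fin n → Fin k) (q : Fin k × Fin k) : Finset (Fin n × Fin n) :=
  (Finset.univ : Finset (Fin n)).offDiag.filter fun p => (z p.1, z p.2) = q

theorem sum_blockPairs {n k : ℕ} (z : Fin n → Fin k) (f : Fin n × Fin n → ℝ) :
    ∑ q, ∑ p ∈ blockPairs z q, f p = ∑ p ∈ (Finset.univ : Finset (Fin n)).offDiag, f p :=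
  Finset.sum_fiberwise _ _ _

theorem frobSq_eq_sum_offDiag {n : ℕ} (B : Fin n → Fin n → ℝ) (hB : ∀ i, B i i = 0) :
    frobSq B = ∑ p ∈ (Finset.univ : Finset (Fin n)).offDiag, B p.1 p.2 ^ 2 := by
  rw [frobSq, ← Fintype.sum_prod_type' (f := fun i j => B i j ^ 2)]
  symm
  apply Finset.sum_subset (Finset.subset_univ _)
  rintro ⟨i, j⟩ - h
  have : i = j := by simpa using h
  simp [this, hB]

theorem sbmMean_diag {n k : ℕ} (z : Fin n → Fin k) (Q : Fin k → Fin k → ℝ) (i : Fin n) :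
    sbmMean z Q i i = 0 := by simp [sbmMean]

theorem sbmMean_of_mem_blockPairs {n k : ℕ} (z : Fin n → Fin k) (Q : Fin k → Fin k → ℝ)
    {p : Fin n × Fin n} {q : Fin k × Fin k} (h : p ∈ blockPairs z q) :
    sbmMean z Q p.1 p.2 = Q q.1 q.2 := by
  simp only [blockPairs, Finset.mem_filter, Finset.mem_offDiag] at h
  obtain ⟨⟨-, -, h⟩, rfl⟩ := h
  simp [sbmMean, h]

/-- Distinct columns of the design have disjoint supports, so only block sizes survive; full rank
therefore means that no block is empty. -/
theorem gram_sbmDesign {n k : ℕ} (z : Fin n → Fin k) :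
    (sbmDesign z).transpose * sbmDesign z
      = Matrix.diagonal fun q => ((blockPairs z q).card : ℝ) := by
  ext q q'
  have h : ∀ p : Fin n × Fin n, sbmDesign z p q * sbmDesign z p q'
      = if q = q' then (if p ∈ blockPairs z q then 1 else 0) else 0 := by
    intro p
    obtain ⟨a, b⟩ := q
    obtain ⟨a', b'⟩ := q'
    simp only [sbmDesign, Matrix.of_apply, blockPairs, Finset.mem_filter, Finset.mem_offDiag,
      Prod.mk.injEq, Finset.mem_univ, true_and]
    grind
  rw [Matrix.mul_apply]
  simp only [Matrix.transpose_apply, h, Matrix.diagonal_apply]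
  split_ifs <;> simp

theorem det_gram_sbmDesign {n k : ℕ} (z : Fin n → Fin k) :
    ((sbmDesign z).transpose * sbmDesign z).det = ∏ q, ((blockPairs z q).card : ℝ) := by
  rw [gram_sbmDesign, Matrix.det_diagonal]

theorem mem_sbmLabels_iff {n k : ℕ} (z : Fin n → Fin k) :
    z ∈ sbmLabels n k ↔ ∀ q, 0 < (blockPairs z q).card := by
  simp only [sbmLabels, Finset.mem_filter, Finset.mem_univ, true_and, det_gram_sbmDesign]
  constructor
  · intro h q
    by_contra h0
    have h0 : (blockPairs z q).card = 0 := by omega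
    exact h.ne' (Finset.prod_eq_zero (Finset.mem_univ q) (by simp [h0]))
  · intro h
    exact Finset.prod_pos fun q _ => by exact_mod_cast h q

theorem mem_sbmLabels_of_surjective {n k : ℕ} (z : Fin n → Fin k)
    (hs : Function.Surjective z) (hz : ∀ i, ∃ j, j ≠ i ∧ z j = z i) : z ∈ sbmLabels n k := by
  rw [mem_sbmLabels_iff]
  rintro ⟨a, b⟩
  obtain ⟨i, rfl⟩ := hs a
  rw [Finset.card_pos]
  by_cases h : b = z i
  · obtain ⟨j, hj, hji⟩ := hz i
    exact ⟨(i, j), by simp [blockPairs, h, hji, hj.symm]⟩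
  · obtain ⟨j, rfl⟩ := hs b
    exact ⟨(i, j), by
      simp only [blockPairs, Finset.mem_filter, Finset.mem_offDiag, Finset.mem_univ, true_and,
        and_true]
      rintro rfl
      exact h rfl⟩

/-- A label vector without singleton communities becomes an admissible one after discarding the
empty communities. -/
theorem exists_label_mem_sbmLabels {n k : ℕ} (hk : 1 ≤ k) (hkn : k ≤ n) (z : Fin n → Fin k)
    (hz : ∀ i, ∃ j, j ≠ i ∧ z j = z i) (Q : Fin k → Fin k → ℝ) (θ : Fin n → Fin n → ℝ)
    (hθ : ∀ i j, i ≠ j → θ i j = Q (z i) (z j)) (hd : ∀ i, θ i i = 0) :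
    ∃ k', 1 ≤ k' ∧ k' ≤ k ∧ ∃ z' ∈ sbmLabels n k', ∃ Q', θ = sbmMean z' Q' := by
  classical
  let e := Fintype.equivFin (Set.range z)
  have hle : Fintype.card (Set.range z) ≤ k := by
    simpa only [Fintype.card_fin] using
      Fintype.card_le_of_injective (Subtype.val : Set.range z → Fin k) Subtype.val_injective
  refine ⟨Fintype.card (Set.range z), ?_, hle, fun i => e ⟨z i, i, rfl⟩, ?_,
    fun a b => Q (e.symm a) (e.symm b), ?_⟩
  · have : Nonempty (Set.range z) := ⟨⟨z ⟨0, by omega⟩, _, rfl⟩⟩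
    exact Fintype.card_pos
  · apply mem_sbmLabels_of_surjective
    · intro a
      obtain ⟨i, hi⟩ := (e.symm a).2
      exact ⟨i, by simp [hi]⟩
    · intro i
      obtain ⟨j, hj, hji⟩ := hz i
      exact ⟨j, hj, by simp [hji]⟩
  · funext i j
    by_cases h : i = j
    · subst h
      simp [sbmMean, hd]
    · simp [sbmMean, h, hθ i j h]

/-! ### Frobenius geometry of block matrices -/

theorem sqrt_frobSq_le {n : ℕ} (B C : Fin n → Fin n → ℝ) :
    √(frobSq B) ≤ √(frobSq C) + √(frobSq (B - C)) := by
  have h : ∀ M : Fin n → Fin n → ℝ,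
      √(frobSq M) = ‖WithLp.toLp 2 (fun p : Fin n × Fin n => M p.1 p.2)‖ := by
    intro M
    simp [EuclideanSpace.norm_eq, frobSq, Fintype.sum_prod_type]
  rw [h, h, h]
  refine le_trans (le_of_eq ?_) (norm_add_le _ _)
  congr 1
  ext p
  simp

theorem frobSq_nonneg {n : ℕ} (B : Fin n → Fin n → ℝ) : 0 ≤ frobSq B :=
  Finset.sum_nonneg fun _ _ => Finset.sum_nonneg fun _ _ => sq_nonneg _

theorem frobSq_neg {n : ℕ} (B : Fin n → Fin n → ℝ) : frobSq (-B) = frobSq B := by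
  simp [frobSq]

theorem frobSq_sbmMean_sub {n k : ℕ} (z : Fin n → Fin k) (Q Q' : Fin k → Fin k → ℝ) :
    frobSq (sbmMean z Q - sbmMean z Q')
      = ∑ q, ((blockPairs z q).card : ℝ) * (Q q.1 q.2 - Q' q.1 q.2) ^ 2 := by
  rw [frobSq_eq_sum_offDiag _ (by simp [sbmMean_diag]), ← sum_blockPairs z]
  refine Finset.sum_congr rfl fun q _ => ?_
  rw [← nsmul_eq_mul, ← Finset.sum_const]
  refine Finset.sum_congr rfl fun p hp => ?_
  simp [sbmMean_of_mem_blockPairs z _ hp]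

/-- Distances to `θ` dominate distances to the block averages of `θ`. -/
theorem exists_sum_le_frobSq_sbmMean_sub {n k : ℕ} (z : Fin n → Fin k)
    (θ : Fin n → Fin n → ℝ) (hθ : ∀ i, θ i i = 0) :
    ∃ m : Fin k × Fin k → ℝ, ∀ Q : Fin k → Fin k → ℝ,
      ∑ q, ((blockPairs z q).card : ℝ) * (Q q.1 q.2 - m q) ^ 2 ≤ frobSq (sbmMean z Q - θ) := by
  refine ⟨fun q => (∑ p ∈ blockPairs z q, θ p.1 p.2) / (blockPairs z q).card, fun Q => ?_⟩
  rw [frobSq_eq_sum_offDiag _ (by simp [sbmMean_diag, hθ]), ← sum_blockPairs z]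
  refine Finset.sum_le_sum fun q _ => ?_
  set m := (∑ p ∈ blockPairs z q, θ p.1 p.2) / (blockPairs z q).card with hm
  rcases Nat.eq_zero_or_pos (blockPairs z q).card with h0 | h0
  · simp only [h0, Nat.cast_zero, zero_mul]
    exact Finset.sum_nonneg fun _ _ => sq_nonneg _
  have hN : ((blockPairs z q).card : ℝ) ≠ 0 := by exact_mod_cast h0.ne'
  have hsum : ∑ p ∈ blockPairs z q, (m - θ p.1 p.2) = 0 := by
    rw [Finset.sum_sub_distrib, Finset.sum_const, nsmul_eq_mul, hm]
    field_simp
    simp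
  have key : ∑ p ∈ blockPairs z q, (sbmMean z Q - θ) p.1 p.2 ^ 2
      = ((blockPairs z q).card : ℝ) * (Q q.1 q.2 - m) ^ 2
        + 2 * (Q q.1 q.2 - m) * ∑ p ∈ blockPairs z q, (m - θ p.1 p.2)
        + ∑ p ∈ blockPairs z q, (m - θ p.1 p.2) ^ 2 := by
    rw [← nsmul_eq_mul, ← Finset.sum_const, Finset.mul_sum, ← Finset.sum_add_distrib,
      ← Finset.sum_add_distrib]
    refine Finset.sum_congr rfl fun p hp => ?_
    simp only [Pi.sub_apply, sbmMean_of_mem_blockPairs z _ hp]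
    ring
  rw [key, hsum]
  have := Finset.sum_nonneg fun p (_ : p ∈ blockPairs z q) => sq_nonneg (m - θ p.1 p.2)
  linarith

/-! ### Gaussian integrals over Q -/

theorem integral_gaussian_shift (b m : ℝ) :
    ∫ x : ℝ, Real.exp (-b * (x - m) ^ 2) = √(Real.pi / b) := by
  rw [integral_sub_right_eq_self (fun x => Real.exp (-b * x ^ 2)) m, integral_gaussian]

theorem integrable_gaussian_shift {b : ℝ} (hb : 0 < b) (m : ℝ) :
    Integrable fun x : ℝ => Real.exp (-b * (x - m) ^ 2) :=
  (integrable_exp_neg_mul_sq hb).comp_sub_right m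

/-- The factor √∏N is the Jacobian of rescaling each coordinate by √N, so neither the block sizes
nor the centre affect the value. -/
theorem lintegral_gaussian_matrix {k : ℕ} (N : Fin k × Fin k → ℝ) (hN : ∀ q, 0 < N q)
    (m : Fin k × Fin k → ℝ) {c : ℝ} (hc : 0 < c) :
    ∫⁻ Q : Fin k → Fin k → ℝ,
        ENNReal.ofReal (√(∏ q, N q) * Real.exp (-(c * ∑ q, N q * (Q q.1 q.2 - m q) ^ 2)))
      = ENNReal.ofReal (√(Real.pi / c) ^ k ^ 2) := by
  let f : Fin k → Fin k → ℝ → ℝ := fun a b x => Real.exp (-(c * N (a, b)) * (x - m (a, b)) ^ 2)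
  have hf : ∀ Q : Fin k → Fin k → ℝ,
      Real.exp (-(c * ∑ q, N q * (Q q.1 q.2 - m q) ^ 2)) = ∏ a, ∏ b, f a b (Q a b) := by
    intro Q
    simp only [f, ← Real.exp_sum]
    congr 1
    rw [Fintype.sum_prod_type, Finset.mul_sum, ← Finset.sum_neg_distrib]
    refine Finset.sum_congr rfl fun a _ => ?_
    rw [Finset.mul_sum, ← Finset.sum_neg_distrib]
    exact Finset.sum_congr rfl fun b _ => by ring
  have hfi : ∀ a b, Integrable (f a b) := fun a b =>
    integrable_gaussian_shift (mul_pos hc (hN _)) _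
  have hrow : ∀ a, Integrable fun v : Fin k → ℝ => ∏ b, f a b (v b) := fun a =>
    Integrable.fintype_prod (hfi a)
  have hint : Integrable fun Q : Fin k → Fin k → ℝ => ∏ a, ∏ b, f a b (Q a b) :=
    Integrable.fintype_prod (f := fun a (v : Fin k → ℝ) => ∏ b, f a b (v b)) hrow
  simp only [hf]
  rw [← ofReal_integral_eq_lintegral_ofReal (hint.const_mul _)
    (ae_of_all _ fun Q => by positivity), integral_const_mul]
  congr 1
  rw [integral_fintype_prod_volume_eq_prod (fun a (v : Fin k → ℝ) => ∏ b, f a b (v b))]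
  have hrow_eq : ∀ a, ∫ v : Fin k → ℝ, ∏ b, f a b (v b) = ∏ b, √(Real.pi / (c * N (a, b))) := by
    intro a
    rw [integral_fintype_prod_volume_eq_prod (f a)]
    exact Finset.prod_congr rfl fun b _ => integral_gaussian_shift _ _
  simp only [hrow_eq]
  rw [← Fintype.prod_prod_type (f := fun q : Fin k × Fin k => √(Real.pi / (c * N q))),
    Real.sqrt_eq_rpow, ← Real.finsetProd_rpow _ _ fun q _ => (hN q).le, ← Finset.prod_mul_distrib]
  have : ∀ q ∈ (Finset.univ : Finset (Fin k × Fin k)),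
      N q ^ (1 / 2 : ℝ) * √(Real.pi / (c * N q)) = √(Real.pi / c) := by
    intro q _
    rw [← Real.sqrt_eq_rpow, ← Real.sqrt_mul (hN q).le]
    congr 1
    have := (hN q).ne'
    field_simp
  rw [Finset.prod_congr rfl this]
  simp [sq]

/-! ### Likelihood ratios under Bernoulli data -/

/-- The exponent of the Gaussian likelihood ratio between `θ` and `θ₀`. -/
def logRatio {n : ℕ} (a θ₀ θ : Fin n → Fin n → ℝ) : ℝ :=
  ∑ p ∈ (Finset.univ : Finset (Fin n)).offDiag,
    ((a p.1 p.2 - θ₀ p.1 p.2) * (θ p.1 p.2 - θ₀ p.1 p.2) - (θ p.1 p.2 - θ₀ p.1 p.2) ^ 2 / 2)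

theorem gaussianLikelihood_eq_mul {n : ℕ} (a θ₀ θ : Fin n → Fin n → ℝ) :
    gaussianLikelihood a θ
      = gaussianLikelihood a θ₀ * ENNReal.ofReal (Real.exp (logRatio a θ₀ θ)) := by
  rw [gaussianLikelihood, gaussianLikelihood, ← ENNReal.ofReal_mul
    (Finset.prod_nonneg fun _ _ => gaussianPDFReal_nonneg _ _ _), logRatio, Real.exp_sum,
    ← Finset.prod_mul_distrib]
  congr 1
  refine Finset.prod_congr rfl fun p _ => ?_
  simp only [gaussianPDFReal, NNReal.coe_one, mul_one]
  rw [mul_assoc, ← Real.exp_add]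
  congr 2
  ring

theorem gaussianLikelihood_pos {n : ℕ} (a θ : Fin n → Fin n → ℝ) : 0 < gaussianLikelihood a θ :=
  ENNReal.ofReal_pos.2 (Finset.prod_pos fun _ _ => gaussianPDFReal_pos _ _ _ one_ne_zero)

theorem sum_offDiag_eq_sum_lt {n : ℕ} (f : Fin n × Fin n → ℝ) :
    ∑ p ∈ (Finset.univ : Finset (Fin n)).offDiag, f p
      = ∑ e : {p : Fin n × Fin n // p.2 < p.1}, (f e.1 + f e.1.swap) := by
  classical
  rw [Finset.sum_add_distrib,
    ← Finset.sum_subtype (Finset.univ.filter fun p : Fin n × Fin n => p.2 < p.1) (by simp) f,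
    ← Finset.sum_subtype (Finset.univ.filter fun p : Fin n × Fin n => p.2 < p.1) (by simp)
      (fun p => f p.swap),
    ← Finset.sum_filter_add_sum_filter_not _ (fun p : Fin n × Fin n => p.2 < p.1)]
  congr 1
  · apply Finset.sum_congr _ fun _ _ => rfl
    ext p
    simp only [Finset.mem_filter, Finset.mem_offDiag, Finset.mem_univ, true_and,
      and_iff_right_iff_imp]
    exact fun h => h.ne'
  · refine Finset.sum_nbij' Prod.swap Prod.swap ?_ ?_ (by simp) (by simp) (by simp)
    · intro p
      simp only [Finset.mem_filter, Finset.mem_offDiag, Finset.mem_univ, true_and, Prod.fst_swap,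
        Prod.snd_swap]
      rintro ⟨h1, h2⟩
      exact lt_of_le_of_ne (not_lt.1 h2) h1
    · intro p
      simp only [Finset.mem_filter, Finset.mem_offDiag, Finset.mem_univ, true_and, Prod.fst_swap,
        Prod.snd_swap]
      exact fun h => ⟨h.ne, not_lt.2 h.le⟩

theorem IsBernoulliGraph.integral_eq {n : ℕ} {Ω : Type*} [MeasurableSpace Ω] {P : Measure Ω}
    [IsProbabilityMeasure P] {A : Ω → Fin n → Fin n → ℝ} {θ : Fin n → Fin n → ℝ}
    (h : IsBernoulliGraph P A θ) {i j : Fin n} (hij : j < i) : ∫ ω, A ω i j ∂P = θ i j := by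
  have hA : (fun ω => A ω i j) = {ω | A ω i j = 1}.indicator (fun _ => (1 : ℝ)) := by
    funext ω
    rcases h.zero_or_one ω i j with h0 | h0 <;> simp [Set.indicator, h0]
  simp only [hA]
  rw [integral_indicator_const _ (show MeasurableSet {ω | A ω i j = 1} from
    h.measurable i j (measurableSet_singleton 1)), ← h.mean i j hij]
  simp

/-- Symmetric Bernoulli noise is sub-Gaussian with variance proxy `1 / 2`. -/
theorem IsBernoulliGraph.lintegral_exp_logRatio_le {n : ℕ} {Ω : Type*} [MeasurableSpace Ω]
    {P : Measure Ω} [IsProbabilityMeasure P] {A : Ω → Fin n → Fin n → ℝ}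
    {θ₀ : Fin n → Fin n → ℝ} (h : IsBernoulliGraph P A θ₀) (hs : ∀ i j, θ₀ i j = θ₀ j i)
    (θ : Fin n → Fin n → ℝ) :
    ∫⁻ ω, ENNReal.ofReal (Real.exp (logRatio (A ω) θ₀ θ)) ∂P
      ≤ ENNReal.ofReal (Real.exp (-(1 / 4) *
          ∑ p ∈ (Finset.univ : Finset (Fin n)).offDiag, (θ - θ₀) p.1 p.2 ^ 2)) := by
  set V := ∑ p ∈ (Finset.univ : Finset (Fin n)).offDiag, (θ - θ₀) p.1 p.2 ^ 2 with hV
  set B : Fin n → Fin n → ℝ := θ - θ₀ with hB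
  let c : {p : Fin n × Fin n // p.2 < p.1} → ℝ := fun e => B e.1.1 e.1.2 + B e.1.2 e.1.1
  let Y : {p : Fin n × Fin n // p.2 < p.1} → Ω → ℝ := fun e ω =>
    c e * (A ω e.1.1 e.1.2 - ∫ ω', A ω' e.1.1 e.1.2 ∂P)
  have hind : iIndepFun Y P := h.indep.comp
    (fun e x => c e * (x - ∫ ω', A ω' e.1.1 e.1.2 ∂P)) fun e => by fun_prop
  have hsubY : ∀ e, HasSubgaussianMGF (Y e) (Real.toNNReal (c e ^ 2 / 4)) P := by
    intro e
    have := (hasSubgaussianMGF_of_mem_Icc (a := 0) (b := 1) (h.measurable e.1.1 e.1.2).aemeasurable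
      (ae_of_all P fun ω => by
        rcases h.zero_or_one ω e.1.1 e.1.2 with h0 | h0 <;> simp [h0])).const_mul (c e)
    convert this using 1
    apply NNReal.eq
    rw [Real.coe_toNNReal _ (by positivity)]
    change c e ^ 2 / 4 = c e ^ 2 * (((‖(1 : ℝ) - 0‖₊ / 2) ^ 2 : NNReal) : ℝ)
    norm_num
    ring
  have hsub := HasSubgaussianMGF.sum_of_iIndepFun hind (s := Finset.univ) fun e _ => hsubY e
  have hY : ∀ ω, logRatio (A ω) θ₀ θ = ∑ e, Y e ω - V / 2 := by
    intro ω
    rw [logRatio, Finset.sum_sub_distrib, ← Finset.sum_div, hV, sum_offDiag_eq_sum_lt]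
    congr 1
    refine Finset.sum_congr rfl fun e _ => ?_
    simp only [Y, c, h.integral_eq e.2, hB, Pi.sub_apply, Prod.fst_swap, Prod.snd_swap,
      h.symm ω e.1.2 e.1.1, hs e.1.2 e.1.1]
    ring
  have hint := hsub.integrable_exp_mul 1
  have hmgf := hsub.mgf_le 1
  simp only [one_mul, mgf] at hint hmgf
  simp_rw [hY, Real.exp_sub, div_eq_mul_inv]
  rw [← ofReal_integral_eq_lintegral_ofReal (hint.mul_const _)
    (ae_of_all _ fun ω => by positivity), integral_mul_const]
  apply ENNReal.ofReal_le_ofReal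
  rw [← Real.exp_neg]
  refine (mul_le_mul_of_nonneg_right hmgf (Real.exp_pos _).le).trans ?_
  rw [← Real.exp_add, Real.exp_le_exp]
  -- The working likelihood counts each edge twice, so the noise coefficient is a sum of two entries
  -- and (a+b)² ≤ 2a²+2b² applies. The noise costs exp(V/4), half of the available V/2.
  have hVc : (∑ e, c e ^ 2) ≤ 2 * V := by
    rw [hV, sum_offDiag_eq_sum_lt, Finset.mul_sum]
    refine Finset.sum_le_sum fun e _ => ?_
    simp only [c, Prod.fst_swap, Prod.snd_swap]
    nlinarith [sq_nonneg (B e.1.1 e.1.2 - B e.1.2 e.1.1)]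
  have hcoe : ((∑ e, Real.toNNReal (c e ^ 2 / 4) : NNReal) : ℝ) = (∑ e, c e ^ 2) / 4 := by
    rw [NNReal.coe_sum, Finset.sum_div]
    exact Finset.sum_congr rfl fun e _ => Real.coe_toNNReal _ (by positivity)
  rw [hcoe]
  linarith

/-! ### Upper and lower integral bounds in one block model -/

/-- The constant in the exponential bounds for a single block model. -/
def laplaceRate (lam : ℝ) : ℝ := 1 + 4 * lam ^ 2 + 3 * lam + 1 / lam

/-- The elliptical Laplace density without its Gamma factors. -/
def laplaceKernel (lam : ℝ) {n k : ℕ} (z : Fin n → Fin k) (Q : Fin k → Fin k → ℝ) : ℝ :=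
  √(∏ q, ((blockPairs z q).card : ℝ)) / 2 * (lam / √Real.pi) ^ (k ^ 2)
    * Real.exp (-lam * √(frobSq (sbmMean z Q)))

theorem measurable_frobSq {n : ℕ} : Measurable (frobSq (n := n)) := by
  unfold frobSq
  fun_prop

theorem measurable_sbmMean {n k : ℕ} (z : Fin n → Fin k) : Measurable (sbmMean z) := by
  unfold sbmMean
  refine measurable_pi_lambda _ fun i => measurable_pi_lambda _ fun j => ?_
  split_ifs
  · exact measurable_const
  · fun_prop

theorem lintegral_laplaceKernel_le {lam : ℝ} (hlam : 0 < lam) {n k : ℕ} (hk : 1 ≤ k)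
    {z : Fin n → Fin k} (hz : z ∈ sbmLabels n k) (θ : Fin n → Fin n → ℝ) (hθ : ∀ i, θ i i = 0)
    (r : ℝ) (S : Set (Fin k → Fin k → ℝ)) (hS : ∀ Q ∈ S, r ≤ frobSq (sbmMean z Q - θ)) :
    ∫⁻ Q, ENNReal.ofReal (laplaceKernel lam z Q)
        * S.indicator (fun Q => ENNReal.ofReal (Real.exp (-(1 / 4) * frobSq (sbmMean z Q - θ)))) Q
      ≤ ENNReal.ofReal
          (Real.exp (-lam * √(frobSq θ) - r / 16 + laplaceRate lam * (k : ℝ) ^ 2)) := by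
  obtain ⟨m, hm⟩ := exists_sum_le_frobSq_sbmMean_sub z θ hθ
  have hN : ∀ q, (0 : ℝ) < (blockPairs z q).card := fun q => by
    exact_mod_cast (mem_sbmLabels_iff z).1 hz q
  set G : ℝ := (lam / √Real.pi) ^ (k ^ 2) / 2
    * Real.exp (-lam * √(frobSq θ) - r / 16 + 4 * lam ^ 2) with hG
  have hG0 : 0 ≤ G := by positivity
  have hpt : ∀ Q : Fin k → Fin k → ℝ, ENNReal.ofReal (laplaceKernel lam z Q)
        * S.indicator (fun Q => ENNReal.ofReal (Real.exp (-(1 / 4) * frobSq (sbmMean z Q - θ)))) Q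
      ≤ ENNReal.ofReal G * ENNReal.ofReal (√(∏ q, ((blockPairs z q).card : ℝ))
          * Real.exp (-((1 / 8) * ∑ q, ((blockPairs z q).card : ℝ) * (Q q.1 q.2 - m q) ^ 2))) := by
    intro Q
    by_cases hQ : Q ∈ S
    · rw [Set.indicator_of_mem hQ, ← ENNReal.ofReal_mul' (Real.exp_pos _).le,
        ← ENNReal.ofReal_mul hG0]
      apply ENNReal.ofReal_le_ofReal
      rw [laplaceKernel, hG, mul_assoc, ← Real.exp_add]
      -- With t the distance to θ, t²/4 is spent in three parts: t²/16 yields r/16, t²/8 is kept for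
      -- the Gaussian integral, and t²/16 absorbs the triangle-inequality loss λt ≤ t²/16 + 4λ².
      have hexp : -lam * √(frobSq (sbmMean z Q)) + -(1 / 4) * frobSq (sbmMean z Q - θ)
          ≤ (-lam * √(frobSq θ) - r / 16 + 4 * lam ^ 2)
            + -((1 / 8) * ∑ q, ((blockPairs z q).card : ℝ) * (Q q.1 q.2 - m q) ^ 2) := by
        have h1 := hm Q
        have h2 := hS Q hQ
        have h3 := sqrt_frobSq_le θ (sbmMean z Q)
        rw [← neg_sub, frobSq_neg] at h3
        have h4 := Real.sq_sqrt (frobSq_nonneg (sbmMean z Q - θ))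
        set t := √(frobSq (sbmMean z Q - θ))
        have h5 : lam * √(frobSq θ) ≤ lam * (√(frobSq (sbmMean z Q)) + t) :=
          mul_le_mul_of_nonneg_left h3 hlam.le
        nlinarith [sq_nonneg (t / 4 - 2 * lam)]
      have := mul_le_mul_of_nonneg_left (Real.exp_le_exp.2 hexp)
        (show 0 ≤ √(∏ q, ((blockPairs z q).card : ℝ)) / 2 * (lam / √Real.pi) ^ (k ^ 2) from
          mul_nonneg (div_nonneg (Real.sqrt_nonneg _) two_pos.le)
            (pow_nonneg (div_nonneg hlam.le (Real.sqrt_nonneg _)) _))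
      refine this.trans (le_of_eq ?_)
      rw [Real.exp_add]
      ring
    · simp [Set.indicator_of_notMem hQ]
  refine (lintegral_mono hpt).trans ?_
  rw [lintegral_const_mul' _ _ ENNReal.ofReal_ne_top,
    lintegral_gaussian_matrix _ hN m (by norm_num), ← ENNReal.ofReal_mul hG0]
  apply ENNReal.ofReal_le_ofReal
  have hπ := Real.sqrt_pos.2 Real.pi_pos
  -- Rounding √8 up to 3 gives the term 3λ of `laplaceRate`.
  have h8 : √(Real.pi / (1 / 8)) ≤ 3 * √Real.pi := by
    rw [Real.sqrt_le_left (by positivity), mul_pow, Real.sq_sqrt Real.pi_pos.le]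
    linarith [Real.pi_pos]
  have hbase : lam / √Real.pi * √(Real.pi / (1 / 8)) ≤ Real.exp (3 * lam) := by
    calc lam / √Real.pi * √(Real.pi / (1 / 8)) ≤ lam / √Real.pi * (3 * √Real.pi) := by gcongr
      _ = 3 * lam := by field_simp
      _ ≤ Real.exp (3 * lam) := by linarith [Real.add_one_le_exp (3 * lam)]
  have hk2 : (1 : ℝ) ≤ (k : ℝ) ^ 2 := one_le_pow₀ (by exact_mod_cast hk)
  calc G * √(Real.pi / (1 / 8)) ^ k ^ 2
      = (lam / √Real.pi * √(Real.pi / (1 / 8))) ^ k ^ 2 / 2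
        * Real.exp (-lam * √(frobSq θ) - r / 16 + 4 * lam ^ 2) := by rw [hG, mul_pow]; ring
    _ ≤ Real.exp (3 * lam) ^ k ^ 2 / 1
        * Real.exp (-lam * √(frobSq θ) - r / 16 + 4 * lam ^ 2) := by
      gcongr
      norm_num
    _ ≤ _ := by
      rw [div_one, ← Real.exp_nat_mul, ← Real.exp_add, Real.exp_le_exp, laplaceRate]
      push_cast
      have : 0 < 1 / lam := by positivity
      nlinarith [sq_nonneg lam]

theorem le_lintegral_laplaceKernel {lam : ℝ} (hlam : 0 < lam) {n k : ℕ} (hk : 1 ≤ k)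
    {z : Fin n → Fin k} (hz : z ∈ sbmLabels n k) (Q₀ : Fin k → Fin k → ℝ)
    (a : Fin n → Fin n → ℝ) :
    ENNReal.ofReal
        (Real.exp (-lam * √(frobSq (sbmMean z Q₀)) - laplaceRate lam * (k : ℝ) ^ 2))
      ≤ ∫⁻ Q, ENNReal.ofReal (laplaceKernel lam z Q)
          * ENNReal.ofReal (Real.exp (logRatio a (sbmMean z Q₀) (sbmMean z Q))) := by
  set θ := sbmMean z Q₀ with hθ
  have hN : ∀ q, (0 : ℝ) < (blockPairs z q).card := fun q => by
    exact_mod_cast (mem_sbmLabels_iff z).1 hz q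
  set w : Fin k × Fin k → ℝ := fun q => ∑ p ∈ blockPairs z q, (a p.1 p.2 - θ p.1 p.2) with hw
  -- The vertex of w x - N x² at x = Q - Q₀: one N/2 comes from the likelihood, the other from λt ≤
  -- t²/2 + λ²/2 applied to the Laplace factor.
  set m : Fin k × Fin k → ℝ := fun q => Q₀ q.1 q.2 + w q / (2 * (blockPairs z q).card) with hm
  have hratio : ∀ Q : Fin k → Fin k → ℝ,
      logRatio a θ (sbmMean z Q) = ∑ q, (w q * (Q q.1 q.2 - Q₀ q.1 q.2)
        - ((blockPairs z q).card : ℝ) * (Q q.1 q.2 - Q₀ q.1 q.2) ^ 2 / 2) := by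
    intro Q
    rw [logRatio, ← sum_blockPairs z]
    refine Finset.sum_congr rfl fun q _ => ?_
    rw [Finset.sum_sub_distrib, hw]
    congr 1
    · rw [Finset.sum_mul]
      refine Finset.sum_congr rfl fun p hp => ?_
      simp only [hθ, sbmMean_of_mem_blockPairs z _ hp]
    · rw [mul_div_assoc, ← nsmul_eq_mul, ← Finset.sum_const]
      refine Finset.sum_congr rfl fun p hp => ?_
      simp only [hθ, sbmMean_of_mem_blockPairs z _ hp]
  set G : ℝ := (lam / √Real.pi) ^ (k ^ 2) / 2
    * Real.exp (-lam * √(frobSq θ) - lam ^ 2 / 2) with hG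
  have hG0 : 0 ≤ G := by positivity
  have hpt : ∀ Q : Fin k → Fin k → ℝ,
      ENNReal.ofReal G * ENNReal.ofReal (√(∏ q, ((blockPairs z q).card : ℝ))
          * Real.exp (-(1 * ∑ q, ((blockPairs z q).card : ℝ) * (Q q.1 q.2 - m q) ^ 2)))
      ≤ ENNReal.ofReal (laplaceKernel lam z Q)
          * ENNReal.ofReal (Real.exp (logRatio a θ (sbmMean z Q))) := by
    intro Q
    rw [← ENNReal.ofReal_mul' (Real.exp_pos _).le, ← ENNReal.ofReal_mul hG0]
    apply ENNReal.ofReal_le_ofReal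
    rw [laplaceKernel, hG, mul_assoc (_ / 2 * _), ← Real.exp_add]
    have hexp : (-lam * √(frobSq θ) - lam ^ 2 / 2)
          + -(1 * ∑ q, ((blockPairs z q).card : ℝ) * (Q q.1 q.2 - m q) ^ 2)
        ≤ -lam * √(frobSq (sbmMean z Q)) + logRatio a θ (sbmMean z Q) := by
      have h3 := sqrt_frobSq_le (sbmMean z Q) θ
      have h4 := Real.sq_sqrt (frobSq_nonneg (sbmMean z Q - θ))
      have h5 : lam * √(frobSq (sbmMean z Q))
          ≤ lam * (√(frobSq θ) + √(frobSq (sbmMean z Q - θ))) :=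
        mul_le_mul_of_nonneg_left h3 hlam.le
      have h6 : -∑ q, ((blockPairs z q).card : ℝ) * (Q q.1 q.2 - m q) ^ 2
          ≤ logRatio a θ (sbmMean z Q) - frobSq (sbmMean z Q - θ) / 2 := by
        rw [hratio, hθ, frobSq_sbmMean_sub, Finset.sum_div, ← Finset.sum_sub_distrib,
          ← Finset.sum_neg_distrib]
        refine Finset.sum_le_sum fun q _ => ?_
        have hNq := hN q
        have : w q * (Q q.1 q.2 - Q₀ q.1 q.2)
              - ((blockPairs z q).card : ℝ) * (Q q.1 q.2 - Q₀ q.1 q.2) ^ 2 / 2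
              - ((blockPairs z q).card : ℝ) * (Q q.1 q.2 - Q₀ q.1 q.2) ^ 2 / 2
            = -(((blockPairs z q).card : ℝ) * (Q q.1 q.2 - m q) ^ 2)
              + w q ^ 2 / (4 * (blockPairs z q).card) := by
          rw [hm]
          field_simp
          ring
        rw [this]
        have : 0 ≤ w q ^ 2 / (4 * (blockPairs z q).card) :=
          div_nonneg (sq_nonneg _) (mul_nonneg (by norm_num) hNq.le)
        linarith
      nlinarith [sq_nonneg (√(frobSq (sbmMean z Q - θ)) - lam)]
    have := mul_le_mul_of_nonneg_left (Real.exp_le_exp.2 hexp)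
      (show 0 ≤ √(∏ q, ((blockPairs z q).card : ℝ)) / 2 * (lam / √Real.pi) ^ (k ^ 2) from
        mul_nonneg (div_nonneg (Real.sqrt_nonneg _) two_pos.le)
          (pow_nonneg (div_nonneg hlam.le (Real.sqrt_nonneg _)) _))
    refine le_trans (le_of_eq ?_) this
    rw [Real.exp_add]
    ring
  refine le_trans ?_ (lintegral_mono hpt)
  rw [lintegral_const_mul' _ _ ENNReal.ofReal_ne_top,
    lintegral_gaussian_matrix _ hN m one_pos, ← ENNReal.ofReal_mul hG0]
  apply ENNReal.ofReal_le_ofReal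
  have hπ := Real.sqrt_pos.2 Real.pi_pos
  have hk2 : (1 : ℝ) ≤ (k : ℝ) ^ 2 := one_le_pow₀ (by exact_mod_cast hk)
  -- For small λ the factor λ^(k²) is small; this bound on its base is the source of 1/λ in
  -- `laplaceRate`.
  have hbase : Real.exp (-(1 / lam)) ≤ lam := by
    rw [Real.exp_neg, inv_le_comm₀ (Real.exp_pos _) hlam, ← one_div]
    linarith [Real.add_one_le_exp (1 / lam)]
  have hhalf : Real.exp (-1) ≤ 1 / 2 := by
    rw [Real.exp_neg, ← one_div]
    gcongr
    linarith [Real.add_one_le_exp 1]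
  have hGeq : G * √(Real.pi / 1) ^ k ^ 2
      = 1 / 2 * lam ^ k ^ 2 * Real.exp (-lam * √(frobSq θ) - lam ^ 2 / 2) := by
    rw [hG, div_one, div_pow]
    field_simp
  rw [hGeq]
  calc _ ≤ Real.exp (-1) * Real.exp (-(1 / lam)) ^ k ^ 2
        * Real.exp (-lam * √(frobSq θ) - lam ^ 2 / 2) := by
        rw [← Real.exp_nat_mul, ← Real.exp_add, ← Real.exp_add, Real.exp_le_exp, laplaceRate]
        push_cast
        nlinarith [sq_nonneg lam]
    _ ≤ _ := by gcongr

/-! ### Mixing over labels and models, and the posterior -/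

theorem measurable_ellipticalLaplace (lam : ℝ) {n k : ℕ} (z : Fin n → Fin k) :
    Measurable (ellipticalLaplace lam z) := by
  unfold ellipticalLaplace
  have := measurable_frobSq.comp (measurable_sbmMean z)
  exact measurable_const.mul (Real.measurable_exp.comp (measurable_const.mul this.sqrt))

theorem sFinite_sum {ι α : Type*} [MeasurableSpace α] (s : Finset ι) (μ : ι → Measure α)
    (h : ∀ i ∈ s, SFinite (μ i)) : SFinite (∑ i ∈ s, μ i) :=
  Finset.sum_induction μ (fun ν => SFinite ν) (fun _ _ _ _ => inferInstance) inferInstance h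

theorem sFinite_sbmPrior (lam D : ℝ) (n : ℕ) : SFinite (sbmPrior lam D n) := by
  refine sFinite_sum _ _ fun k _ => ?_
  have := sFinite_sum (sbmLabels n k) (fun z => ((sbmLabels n k).card : ENNReal)⁻¹ •
      Measure.map (fun Q : Fin k → Fin k → ℝ => (k, sbmMean z Q))
        ((volume : Measure (Fin k → Fin k → ℝ)).withDensity
          fun Q => ENNReal.ofReal (ellipticalLaplace lam z Q))) fun z _ => inferInstance
  infer_instance

theorem sbmWeight_pos (D : ℝ) {n k : ℕ} (hk : 1 ≤ k) : 0 < sbmWeight D n k := by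
  have : (0 : ℝ) < k := by exact_mod_cast hk
  have h1 : 0 < Real.Gamma ((k : ℝ) ^ 2) := Real.Gamma_pos_of_pos (by positivity)
  have h2 : 0 < Real.Gamma ((k : ℝ) ^ 2 / 2) := Real.Gamma_pos_of_pos (by positivity)
  exact mul_pos (div_pos h1 h2) (Real.exp_pos _)

theorem one_le_of_mem_sbmModels {n k : ℕ} (h : k ∈ sbmModels n) : 1 ≤ k := by
  simp only [sbmModels, Finset.mem_filter, Finset.mem_Icc] at h
  exact h.1.1

/-- The Gamma factors of the model weights and of the Laplace densities cancel. -/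
theorem sbmProb_mul_ellipticalLaplace (lam D : ℝ) {n k : ℕ} (hk : 1 ≤ k) (z : Fin n → Fin k)
    (Q : Fin k → Fin k → ℝ) :
    sbmProb D n k * ellipticalLaplace lam z Q
      = Real.exp (-D * sbmComplexity n k) / (∑ j ∈ sbmModels n, sbmWeight D n j)
        * laplaceKernel lam z Q := by
  have : (0 : ℝ) < k := by exact_mod_cast hk
  have h1 := (Real.Gamma_pos_of_pos (show 0 < (k : ℝ) ^ 2 by positivity)).ne'
  have h2 := (Real.Gamma_pos_of_pos (show 0 < (k : ℝ) ^ 2 / 2 by positivity)).ne'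
  rw [sbmProb, sbmWeight, ellipticalLaplace, laplaceKernel, det_gram_sbmDesign]
  generalize Real.Gamma ((k : ℝ) ^ 2) = g at *
  generalize Real.Gamma ((k : ℝ) ^ 2 / 2) = g' at *
  field_simp

theorem lintegral_sbmPrior (lam D : ℝ) (n : ℕ) {f : ℕ × (Fin n → Fin n → ℝ) → ENNReal}
    (hf : Measurable f) :
    ∫⁻ x, f x ∂sbmPrior lam D n
      = ∑ k ∈ sbmModels n, ENNReal.ofReal
            (Real.exp (-D * sbmComplexity n k) / ∑ j ∈ sbmModels n, sbmWeight D n j)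
          * ∑ z ∈ sbmLabels n k, ((sbmLabels n k).card : ENNReal)⁻¹
            * ∫⁻ Q, ENNReal.ofReal (laplaceKernel lam z Q) * f (k, sbmMean z Q) := by
  rw [sbmPrior, lintegral_finsetSum_measure]
  refine Finset.sum_congr rfl fun k hk => ?_
  rw [lintegral_smul_measure, lintegral_finsetSum_measure, smul_eq_mul, Finset.mul_sum,
    Finset.mul_sum]
  refine Finset.sum_congr rfl fun z _ => ?_
  have hg : Measurable fun Q : Fin k → Fin k → ℝ => (k, sbmMean z Q) :=
    measurable_const.prodMk (measurable_sbmMean z)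
  have hfg : Measurable fun Q => f (k, sbmMean z Q) := hf.comp hg
  have hell := (measurable_ellipticalLaplace lam z).ennreal_ofReal
  have hT : 0 ≤ ∑ j ∈ sbmModels n, sbmWeight D n j :=
    Finset.sum_nonneg fun j hj => (sbmWeight_pos D (one_le_of_mem_sbmModels hj)).le
  rw [lintegral_smul_measure, lintegral_map hf hg, lintegral_withDensity_eq_lintegral_mul _ hell hfg,
    smul_eq_mul, mul_left_comm, mul_left_comm (ENNReal.ofReal (_ / _)),
    ← lintegral_const_mul' _ _ ENNReal.ofReal_ne_top,
    ← lintegral_const_mul' _ _ ENNReal.ofReal_ne_top]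
  congr 1
  refine lintegral_congr fun Q => ?_
  simp only [Pi.mul_apply]
  rw [← mul_assoc, ← mul_assoc, ← ENNReal.ofReal_mul (div_nonneg (Real.exp_pos _).le hT),
    ← ENNReal.ofReal_mul (show 0 ≤ sbmProb D n k from div_nonneg
      (sbmWeight_pos D (one_le_of_mem_sbmModels hk)).le hT),
    ← sbmProb_mul_ellipticalLaplace lam D (one_le_of_mem_sbmModels hk)]

theorem measurable_logRatio {n : ℕ} (θ₀ : Fin n → Fin n → ℝ) :
    Measurable fun x : (Fin n → Fin n → ℝ) × (Fin n → Fin n → ℝ) => logRatio x.1 θ₀ x.2 := by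
  unfold logRatio
  fun_prop

/-- The likelihood at θ₀ cancels between numerator and evidence, which leaves likelihood ratios
only. -/
theorem sbmPosterior_le {lam D : ℝ} {n : ℕ} (a θ₀ : Fin n → Fin n → ℝ)
    {S : Set (ℕ × (Fin n → Fin n → ℝ))} (hS : MeasurableSet S) {b : ENNReal}
    (hb : b ≤ ∫⁻ x, ENNReal.ofReal (Real.exp (logRatio a θ₀ x.2)) ∂sbmPrior lam D n) :
    sbmPosterior lam D a S
      ≤ b⁻¹ * ∫⁻ x in S, ENNReal.ofReal (Real.exp (logRatio a θ₀ x.2)) ∂sbmPrior lam D n := by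
  have h0 := (gaussianLikelihood_pos a θ₀).ne'
  have htop : gaussianLikelihood a θ₀ ≠ ⊤ := ENNReal.ofReal_ne_top
  rw [sbmPosterior, Measure.smul_apply, withDensity_apply _ hS, smul_eq_mul]
  simp only [fun x : ℕ × (Fin n → Fin n → ℝ) => gaussianLikelihood_eq_mul a θ₀ x.2]
  rw [lintegral_const_mul' _ _ htop, lintegral_const_mul' _ _ htop,
    ENNReal.mul_inv (Or.inl h0) (Or.inl htop), mul_mul_mul_comm, ENNReal.inv_mul_cancel h0 htop,
    one_mul]
  gcongr

theorem card_sbmLabels_le (n k : ℕ) (hk : 1 ≤ k) :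
    ((sbmLabels n k).card : ℝ) ≤ Real.exp (n * Real.log k) := by
  have h : (sbmLabels n k).card ≤ k ^ n := by
    simpa using Finset.card_le_univ (sbmLabels n k)
  have hk' : (0 : ℝ) < k := by exact_mod_cast hk
  rw [Real.exp_nat_mul, Real.exp_log hk']
  exact_mod_cast h

theorem mem_sbmModels {n k : ℕ} (hk : 1 ≤ k) (hkn : k ≤ n) {z : Fin n → Fin k}
    (hz : z ∈ sbmLabels n k) : k ∈ sbmModels n := by
  simp only [sbmModels, Finset.mem_filter, Finset.mem_Icc]
  exact ⟨⟨hk, hkn⟩, z, hz⟩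

theorem sq_le_sbmComplexity (n k : ℕ) : (k : ℝ) ^ 2 ≤ sbmComplexity n k := by
  have := Real.log_natCast_nonneg k
  rw [sbmComplexity]
  have : 0 ≤ (n : ℝ) * Real.log k := by positivity
  linarith

theorem one_le_laplaceRate {lam : ℝ} (hlam : 0 < lam) : 1 ≤ laplaceRate lam := by
  rw [laplaceRate]
  have : 0 < 1 / lam := by positivity
  nlinarith [sq_nonneg lam]

/-- Keeping only the true model and label vector costs the prior mass of that label vector, at least
exp(-n log k); since `laplaceRate` is at least 1, the complexity term absorbs it. -/
theorem le_lintegral_sbmPrior {lam : ℝ} (hlam : 0 < lam) (D : ℝ) {n k : ℕ} (hk : 1 ≤ k)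
    (hkn : k ≤ n) {z : Fin n → Fin k} (hz : z ∈ sbmLabels n k) (Q₀ : Fin k → Fin k → ℝ)
    (a : Fin n → Fin n → ℝ) :
    ENNReal.ofReal (Real.exp (-lam * √(frobSq (sbmMean z Q₀))
          - (D + laplaceRate lam) * sbmComplexity n k) / ∑ j ∈ sbmModels n, sbmWeight D n j)
      ≤ ∫⁻ x, ENNReal.ofReal (Real.exp (logRatio a (sbmMean z Q₀) x.2)) ∂sbmPrior lam D n := by
  have hmeas : Measurable fun x : ℕ × (Fin n → Fin n → ℝ) =>
      ENNReal.ofReal (Real.exp (logRatio a (sbmMean z Q₀) x.2)) :=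
    (Real.measurable_exp.comp ((measurable_logRatio (sbmMean z Q₀)).comp
      (measurable_const.prodMk measurable_snd))).ennreal_ofReal
  have hT : 0 ≤ ∑ j ∈ sbmModels n, sbmWeight D n j :=
    Finset.sum_nonneg fun j hj => (sbmWeight_pos D (one_le_of_mem_sbmModels hj)).le
  have hcard : (0 : ℝ) < (sbmLabels n k).card := by
    exact_mod_cast Finset.card_pos.2 ⟨z, hz⟩
  rw [lintegral_sbmPrior lam D n hmeas]
  refine le_trans ?_ (Finset.single_le_sum (fun _ _ => zero_le) (mem_sbmModels hk hkn hz))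
  refine le_trans ?_ (mul_le_mul_right (Finset.single_le_sum (fun _ _ => zero_le) hz) _)
  refine le_trans ?_ (mul_le_mul_right (mul_le_mul_right
    (le_lintegral_laplaceKernel hlam hk hz Q₀ a) _) _)
  rw [← ENNReal.ofReal_natCast, ← ENNReal.ofReal_inv_of_pos hcard,
    ← ENNReal.ofReal_mul (by positivity), ← ENNReal.ofReal_mul (by positivity)]
  apply ENNReal.ofReal_le_ofReal
  rw [div_mul_eq_mul_div]
  apply div_le_div_of_nonneg_right _ hT
  have hinv : Real.exp (-(n * Real.log k)) ≤ ((sbmLabels n k).card : ℝ)⁻¹ := by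
    rw [Real.exp_neg]
    exact inv_anti₀ hcard (card_sbmLabels_le n k hk)
  calc _ ≤ Real.exp (-D * sbmComplexity n k) * (Real.exp (-(n * Real.log k))
        * Real.exp (-lam * √(frobSq (sbmMean z Q₀)) - laplaceRate lam * (k : ℝ) ^ 2)) := by
        rw [← Real.exp_add, ← Real.exp_add, Real.exp_le_exp]
        have h1 := one_le_laplaceRate hlam
        have h2 : 0 ≤ (n : ℝ) * Real.log k :=
          mul_nonneg (Nat.cast_nonneg n) (Real.log_natCast_nonneg k)
        have h3 := mul_le_mul_of_nonneg_right h1 h2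
        have h4 : sbmComplexity n k = (k : ℝ) ^ 2 + n * Real.log k := rfl
        rw [h4]
        linarith
    _ ≤ _ := by gcongr

/-- The single-model bound is uniform in z, so averaging over labels costs nothing, and models
outside K contribute zero. -/
theorem setLIntegral_sbmPrior_le {lam D : ℝ} (hlam : 0 < lam) {n : ℕ}
    (θ₀ : Fin n → Fin n → ℝ) (hθ₀ : ∀ i, θ₀ i i = 0) {S : Set (ℕ × (Fin n → Fin n → ℝ))}
    (hS : MeasurableSet S) (K : Finset ℕ) (r : ℝ)
    (hSK : ∀ x ∈ S, x.1 ∈ sbmModels n → x.1 ∈ K ∧ r ≤ frobSq (x.2 - θ₀)) :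
    ∫⁻ x in S, ENNReal.ofReal (Real.exp (-(1 / 4) *
        ∑ p ∈ (Finset.univ : Finset (Fin n)).offDiag, (x.2 - θ₀) p.1 p.2 ^ 2)) ∂sbmPrior lam D n
      ≤ ENNReal.ofReal (Real.exp (-lam * √(frobSq θ₀) - r / 16)
          * (∑ k ∈ K, Real.exp (-(D - laplaceRate lam) * sbmComplexity n k))
          / ∑ j ∈ sbmModels n, sbmWeight D n j) := by
  have hmeas : Measurable fun x : ℕ × (Fin n → Fin n → ℝ) =>
      ENNReal.ofReal (Real.exp (-(1 / 4) *
        ∑ p ∈ (Finset.univ : Finset (Fin n)).offDiag, (x.2 - θ₀) p.1 p.2 ^ 2)) := by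
    simp only [Pi.sub_apply]
    fun_prop
  have hT : 0 ≤ ∑ j ∈ sbmModels n, sbmWeight D n j :=
    Finset.sum_nonneg fun j hj => (sbmWeight_pos D (one_le_of_mem_sbmModels hj)).le
  set T := ∑ j ∈ sbmModels n, sbmWeight D n j
  have hterm : ∀ k, 0 ≤ Real.exp (-lam * √(frobSq θ₀) - r / 16)
      * Real.exp (-(D - laplaceRate lam) * sbmComplexity n k) / T := fun k => by positivity
  rw [← lintegral_indicator hS, lintegral_sbmPrior lam D n (hmeas.indicator hS), Finset.mul_sum,
    Finset.sum_div, ENNReal.ofReal_sum_of_nonneg fun k _ => hterm k]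
  have hblock : ∀ k ∈ sbmModels n, ENNReal.ofReal (Real.exp (-D * sbmComplexity n k) / T)
        * ∑ z ∈ sbmLabels n k, ((sbmLabels n k).card : ENNReal)⁻¹
          * ∫⁻ Q, ENNReal.ofReal (laplaceKernel lam z Q) * S.indicator (fun x =>
            ENNReal.ofReal (Real.exp (-(1 / 4) * ∑ p ∈ (Finset.univ : Finset (Fin n)).offDiag,
              (x.2 - θ₀) p.1 p.2 ^ 2))) (k, sbmMean z Q)
      ≤ if k ∈ K then ENNReal.ofReal (Real.exp (-lam * √(frobSq θ₀) - r / 16)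
          * Real.exp (-(D - laplaceRate lam) * sbmComplexity n k) / T) else 0 := by
    intro k hk
    have hk1 := one_le_of_mem_sbmModels hk
    split_ifs with hkK
    · have hz : ∀ z ∈ sbmLabels n k, ((sbmLabels n k).card : ENNReal)⁻¹
          * ∫⁻ Q, ENNReal.ofReal (laplaceKernel lam z Q) * S.indicator (fun x =>
            ENNReal.ofReal (Real.exp (-(1 / 4) * ∑ p ∈ (Finset.univ : Finset (Fin n)).offDiag,
              (x.2 - θ₀) p.1 p.2 ^ 2))) (k, sbmMean z Q)
          ≤ ((sbmLabels n k).card : ENNReal)⁻¹ * ENNReal.ofReal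
            (Real.exp (-lam * √(frobSq θ₀) - r / 16 + laplaceRate lam * (k : ℝ) ^ 2)) := by
        intro z hz
        gcongr
        refine le_trans (le_of_eq ?_) (lintegral_laplaceKernel_le hlam hk1 hz θ₀ hθ₀ r
          ((fun Q => (k, sbmMean z Q)) ⁻¹' S) fun Q hQ => (hSK _ hQ hk).2)
        refine lintegral_congr fun Q => ?_
        have hfrob := frobSq_eq_sum_offDiag (sbmMean z Q - θ₀) (by simp [sbmMean_diag, hθ₀])
        simp only [Set.indicator, hfrob]
        rfl
      refine (mul_le_mul_right (Finset.sum_le_sum hz) _).trans ?_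
      have hcard : ∑ _z ∈ sbmLabels n k, ((sbmLabels n k).card : ENNReal)⁻¹ ≤ 1 := by
        rw [Finset.sum_const, nsmul_eq_mul]
        exact ENNReal.mul_inv_le_one _
      rw [← Finset.sum_mul]
      refine (mul_le_mul_right (mul_le_mul_left hcard _) _).trans ?_
      rw [one_mul, ← ENNReal.ofReal_mul (by positivity)]
      apply ENNReal.ofReal_le_ofReal
      rw [div_mul_eq_mul_div]
      apply div_le_div_of_nonneg_right _ hT
      rw [← Real.exp_add, ← Real.exp_add, Real.exp_le_exp]
      have h1 := one_le_laplaceRate hlam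
      have h2 := mul_le_mul_of_nonneg_left (sq_le_sbmComplexity n k) (zero_le_one.trans h1)
      linarith
    · have hz : ∀ z : Fin n → Fin k, ∀ Q, (k, sbmMean z Q) ∉ S := fun z Q h =>
        hkK (hSK _ h hk).1
      simp [Set.indicator_of_notMem (hz _ _)]
  refine (Finset.sum_le_sum hblock).trans ?_
  rw [← Finset.sum_filter]
  exact Finset.sum_le_sum_of_subset fun k hk => (Finset.mem_filter.1 hk).2

/-- The posterior mass of a set of models and means is controlled by the complexities of the
models and by the distance to the truth. -/
theorem lintegral_sbmPosterior_le {lam D : ℝ} (hlam : 0 < lam) {n k : ℕ} (hk : 1 ≤ k)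
    (hkn : k ≤ n) {z : Fin n → Fin k} (hz : z ∈ sbmLabels n k) (Q₀ : Fin k → Fin k → ℝ)
    (hs : ∀ i j, sbmMean z Q₀ i j = sbmMean z Q₀ j i) {Ω : Type*} [MeasurableSpace Ω]
    {P : Measure Ω} [IsProbabilityMeasure P] {A : Ω → Fin n → Fin n → ℝ}
    (hA : IsBernoulliGraph P A (sbmMean z Q₀)) {S : Set (ℕ × (Fin n → Fin n → ℝ))}
    (hS : MeasurableSet S) (K : Finset ℕ) (r : ℝ)
    (hSK : ∀ x ∈ S, x.1 ∈ sbmModels n → x.1 ∈ K ∧ r ≤ frobSq (x.2 - sbmMean z Q₀)) :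
    ∫⁻ ω, sbmPosterior lam D (A ω) S ∂P
      ≤ ENNReal.ofReal (Real.exp ((D + laplaceRate lam) * sbmComplexity n k - r / 16)
          * ∑ k ∈ K, Real.exp (-(D - laplaceRate lam) * sbmComplexity n k)) := by
  set θ₀ := sbmMean z Q₀ with hθ₀
  have hT : 0 < ∑ j ∈ sbmModels n, sbmWeight D n j :=
    Finset.sum_pos (fun j hj => sbmWeight_pos D (one_le_of_mem_sbmModels hj))
      ⟨k, mem_sbmModels hk hkn hz⟩
  have hden := fun ω => le_lintegral_sbmPrior hlam D hk hkn hz Q₀ (A ω)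
  rw [← hθ₀] at hden
  have hdiag : ∀ i, θ₀ i i = 0 := sbmMean_diag z Q₀
  clear_value θ₀
  set T := ∑ j ∈ sbmModels n, sbmWeight D n j
  set b := Real.exp (-lam * √(frobSq θ₀) - (D + laplaceRate lam) * sbmComplexity n k) / T with hb
  have hb0 : 0 < b := by positivity
  have hsf := sFinite_sbmPrior lam D n
  have hAm : Measurable A :=
    measurable_pi_lambda _ fun i => measurable_pi_lambda _ fun j => hA.measurable i j
  have hmeas : Measurable (Function.uncurry fun (ω : Ω) (x : ℕ × (Fin n → Fin n → ℝ)) =>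
      ENNReal.ofReal (Real.exp (logRatio (A ω) θ₀ x.2))) :=
    (Real.measurable_exp.comp ((measurable_logRatio θ₀).comp
      ((hAm.comp measurable_fst).prodMk (measurable_snd.comp measurable_snd)))).ennreal_ofReal
  calc ∫⁻ ω, sbmPosterior lam D (A ω) S ∂P
      ≤ ∫⁻ ω, (ENNReal.ofReal b)⁻¹ * ∫⁻ x in S,
          ENNReal.ofReal (Real.exp (logRatio (A ω) θ₀ x.2)) ∂sbmPrior lam D n ∂P :=
        lintegral_mono fun ω => sbmPosterior_le (A ω) θ₀ hS (hden ω)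
    -- The evidence bound b does not depend on ω, so the expectation reaches the likelihood ratio
    -- itself.
    _ = (ENNReal.ofReal b)⁻¹ * ∫⁻ x in S, ∫⁻ ω,
          ENNReal.ofReal (Real.exp (logRatio (A ω) θ₀ x.2)) ∂P ∂sbmPrior lam D n := by
        rw [lintegral_const_mul' _ _ (ENNReal.inv_ne_top.2 (ENNReal.ofReal_pos.2 hb0).ne'),
          lintegral_lintegral_swap hmeas.aemeasurable]
    _ ≤ (ENNReal.ofReal b)⁻¹ * ENNReal.ofReal (Real.exp (-lam * √(frobSq θ₀) - r / 16)
          * (∑ k ∈ K, Real.exp (-(D - laplaceRate lam) * sbmComplexity n k)) / T) := by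
        gcongr
        refine le_trans (lintegral_mono fun x : ℕ × (Fin n → Fin n → ℝ) =>
          hA.lintegral_exp_logRatio_le hs x.2) ?_
        exact setLIntegral_sbmPrior_le hlam θ₀ hdiag hS K r hSK
    _ = _ := by
        rw [← ENNReal.ofReal_inv_of_pos hb0, ← ENNReal.ofReal_mul (inv_nonneg.2 hb0.le), hb]
        congr 1
        have h1 : Real.exp ((D + laplaceRate lam) * sbmComplexity n k - r / 16)
            = Real.exp (-lam * √(frobSq θ₀) - r / 16)
              / Real.exp (-lam * √(frobSq θ₀) - (D + laplaceRate lam) * sbmComplexity n k) := by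
          rw [← Real.exp_sub]
          congr 1
          ring
        rw [h1]
        field_simp

/-! ### Summing over models and choosing constants -/

/-- One unit of the exponent D is set aside: ε(k) ≥ k² ≥ k turns it into 2^(-k), whose sum over k ≥
1 is at most 1, so no prefactor is lost. -/
theorem sum_exp_sbmComplexity_le {D E x : ℝ} (hE : E + 1 ≤ D) (hE0 : 0 ≤ E) (n : ℕ)
    (K : Finset ℕ) (hK : ∀ k ∈ K, 1 ≤ k ∧ x ≤ sbmComplexity n k) :
    ∑ k ∈ K, Real.exp (-D * sbmComplexity n k) ≤ Real.exp (-E * x) := by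
  have hpt : ∀ k ∈ K, Real.exp (-D * sbmComplexity n k)
      ≤ Real.exp (-E * x) * ((1 / 2 : ℝ) ^ (k - 1) * (1 / 2)) := by
    intro k hk
    obtain ⟨h1, h2⟩ := hK k hk
    have hk1 : (1 : ℝ) ≤ k := by exact_mod_cast h1
    have h3 : (k : ℝ) ≤ sbmComplexity n k := by nlinarith [sq_le_sbmComplexity n k]
    have h4 : -D * sbmComplexity n k ≤ -E * x + k * (-1) := by nlinarith
    have hhalf : Real.exp (-1) ≤ 1 / 2 := by
      rw [Real.exp_neg, ← one_div]
      gcongr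
      linarith [Real.add_one_le_exp 1]
    calc _ ≤ Real.exp (-E * x) * Real.exp (-1) ^ k := by
          rw [← Real.exp_nat_mul, ← Real.exp_add, Real.exp_le_exp]
          exact h4
      _ ≤ Real.exp (-E * x) * (1 / 2) ^ k := by gcongr
      _ = _ := by rw [← pow_succ, Nat.sub_add_cancel h1]
  refine (Finset.sum_le_sum hpt).trans ?_
  rw [← Finset.mul_sum, ← Finset.sum_mul]
  have hgeom : ∑ k ∈ K, (1 / 2 : ℝ) ^ (k - 1) ≤ 2 := by
    rw [← Finset.sum_image (f := fun j => (1 / 2 : ℝ) ^ j) (g := fun k => k - 1) (by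
      intro a ha b hb hab
      have := (hK a ha).1
      have := (hK b hb).1
      simp only at hab
      omega)]
    exact (summable_geometric_two.sum_le_tsum _ fun _ _ => by positivity).trans_eq
      tsum_geometric_two
  exact mul_le_of_le_one_right (Real.exp_pos _).le (by linarith)

theorem sbmComplexity_mono {n k k' : ℕ} (h1 : 1 ≤ k) (h : k ≤ k') :
    sbmComplexity n k ≤ sbmComplexity n k' := by
  have : (0 : ℝ) < k := by exact_mod_cast h1
  unfold sbmComplexity
  gcongr

end

theorem corollary2 (lam δ : ℝ) (hlam : 0 < lam) (hδ_pos : 0 < δ) (hδ_lt : δ < 1) :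
    ∃ D₀ > 0, ∀ D > D₀, ∃ M > 0, ∃ C₁ > 0, ∃ C₂ > 0,
      ∀ (n kstar : ℕ), 1 ≤ kstar → kstar ≤ n →
      ∀ (zstar : Fin n → Fin kstar), (∀ i, ∃ j, j ≠ i ∧ zstar j = zstar i) →
      ∀ (Qstar : Fin kstar → Fin kstar → ℝ) (θstar : Fin n → Fin n → ℝ),
      (∀ i j, i ≠ j → θstar i j = Qstar (zstar i) (zstar j) ∧
        Qstar (zstar i) (zstar j) = Qstar (zstar j) (zstar i) ∧ θstar i j ∈ Set.Icc (0 : ℝ) 1) →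
      (∀ i, θstar i i = 0) →
      ∀ (Ω : Type*) [MeasurableSpace Ω] (P : Measure Ω) [IsProbabilityMeasure P]
        (A : Ω → Fin n → Fin n → ℝ), IsBernoulliGraph P A θstar →
      (∫⁻ ω, sbmPosterior lam D (A ω)
          {x | sbmComplexity n x.1 > (1 + δ) * sbmComplexity n kstar} ∂P
        ≤ ENNReal.ofReal (Real.exp (-C₁ * sbmComplexity n kstar))) ∧
      (∫⁻ ω, sbmPosterior lam D (A ω)
          {x | frobSq (x.2 - θstar) > M * sbmComplexity n kstar} ∂P
        ≤ ENNReal.ofReal (Real.exp (-C₂ * sbmComplexity n kstar))) := by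
  set C := laplaceRate lam
  have hC : 1 ≤ C := one_le_laplaceRate hlam
  -- The first claim needs (D-C-1)(1+δ) - (D+C) ≥ 1; as δ < 1, δD ≥ 3C+3 would do, so this threshold
  -- has slack.
  refine ⟨(5 * C + 3) / δ, by positivity, fun D hD => ?_⟩
  have hδD : 5 * C + 3 < δ * D := by rwa [gt_iff_lt, div_lt_iff₀' hδ_pos] at hD
  have hD1 : 5 * C + 3 < D := by nlinarith
  -- With r = M·R, r/16 exceeds the evidence cost (D+C)R by exactly R, hence the rate 1.
  refine ⟨16 * (D + C + 1), by linarith, 1, one_pos, 1, one_pos, ?_⟩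
  intro n kstar hk hkn zstar hzstar Qstar θstar hθ hdiag Ω _ P _ A hA
  -- Some communities of `zstar` may be empty, so the evidence bound uses the reduced k ≤ `kstar`;
  -- monotonicity of the complexity restores `kstar` in the result.
  obtain ⟨k, hk1, hkk, z, hz, Q, rfl⟩ := exists_label_mem_sbmLabels hk hkn zstar hzstar Qstar θstar
    (fun i j hij => (hθ i j hij).1) hdiag
  have hs : ∀ i j, sbmMean z Q i j = sbmMean z Q j i := by
    intro i j
    by_cases hij : i = j
    · rw [hij]
    · rw [(hθ i j hij).1, (hθ j i (Ne.symm hij)).1, (hθ i j hij).2.1]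
  set R := sbmComplexity n kstar
  have hkR : sbmComplexity n k ≤ R := sbmComplexity_mono hk1 hkk
  have hR : 1 ≤ R := (one_le_pow₀ (by exact_mod_cast hk)).trans (sq_le_sbmComplexity n kstar)
  have hDk : (D + C) * sbmComplexity n k ≤ (D + C) * R :=
    mul_le_mul_of_nonneg_left hkR (by linarith)
  constructor
  · classical
    refine (lintegral_sbmPosterior_le hlam hk1 (hkk.trans hkn) hz Q hs hA
      ((measurable_from_nat (f := sbmComplexity n)).comp measurable_fst measurableSet_Ioi)
      ((sbmModels n).filter fun k => (1 + δ) * R ≤ sbmComplexity n k) 0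
      fun x hx hxm => ⟨Finset.mem_filter.2 ⟨hxm, le_of_lt hx⟩, frobSq_nonneg _⟩).trans ?_
    apply ENNReal.ofReal_le_ofReal
    refine (mul_le_mul_of_nonneg_left (sum_exp_sbmComplexity_le (E := D - C - 1)
      (x := (1 + δ) * R) (by linarith) (by linarith) n _ fun k hk =>
        ⟨one_le_of_mem_sbmModels (Finset.mem_filter.1 hk).1, (Finset.mem_filter.1 hk).2⟩)
      (Real.exp_pos _).le).trans ?_
    rw [← Real.exp_add, Real.exp_le_exp]
    have : 1 ≤ (D - C - 1) * (1 + δ) - (D + C) := by nlinarith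
    nlinarith
  · refine (lintegral_sbmPosterior_le hlam hk1 (hkk.trans hkn) hz Q hs hA
      ((measurable_frobSq.comp (measurable_snd.sub_const _)) measurableSet_Ioi)
      (sbmModels n) (16 * (D + C + 1) * R)
      fun x hx hxm => ⟨hxm, le_of_lt hx⟩).trans ?_
    apply ENNReal.ofReal_le_ofReal
    refine (mul_le_mul_of_nonneg_left (sum_exp_sbmComplexity_le (E := 0) (x := 0)
      (by linarith) le_rfl n _ fun k hk => ⟨one_le_of_mem_sbmModels hk,
        (sq_nonneg _).trans (sq_le_sbmComplexity n k)⟩) (Real.exp_pos _).le).trans ?_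
    rw [← Real.exp_add, Real.exp_le_exp]
    linarith
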